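/- **Definitions.** For $n\ge 1$ let $Q_n=(q_{k,j})_{0\le k,j\le n-1}$ be the real orthogonal matrix with $q_{k,j}=\alpha_j\cos(2\pi kj/n)$ for $0\le j\le\lfloor n/2\rfloor$ and $q_{k,j}=\alpha_j\sin(2\pi k(n-j)/n)$ for $\lfloor n/2\rfloor<j\le n-1$, where $\alpha_j=1/\sqrt n$ if $j=0$ or $j=n/2$, and $\alpha_j=\sqrt{2/n}$ otherwise. Let $\mathcal G_n=\{Q_n\,\mathrm{diag}(\lambda)\,Q_n^T:\lambda\in\mathbb R^n\}$ (the $\gamma$-matrices), and let $\mathcal C_n$ and $\mathcal B_n$ be the subsets of $\mathcal G_n$ given by the vectors $\lambda$ with $\lambda_j=\lambda_{(n-j)\bmod n}$ for all $j$, respectively $\lambda_j=-\lambda_{(n-j)\bmod n}$ for all $j$. Let $f(z)=\sum_{j=-\infty}^{+\infty}t_jz^j$, $|z|=1$, where $t_j=t_{-j}\in\mathbb R$ and $\sum_j|t_j|<\infty$ (so $f$ is a real-valued function of the Wiener class), let $f_{\min}$ and $f_{\max}$ be the minimum and the maximum of $f$ on the unit circle, and let $T_n(f)=(t_{|k-j|})_{0\le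 k,j\le n-1}$ be the real symmetric Toeplitz matrix generated by $f$. Let $G_n(f)=C_n(f)+B_n(f)$, with $C_n(f)\in\mathcal C_n$ and $B_n(f)\in\mathcal B_n$, be its optimal $\gamma$-approximation, that is, the minimizer of the Frobenius distance $\|G-T_n(f)\|_F$ over $G\in\mathcal G_n$. **Theorem.** (1) For every $\varepsilon>0$ there is a positive integer $n_0$ such that, for every $n\ge n_0$, every eigenvalue of $G_n(f)$ lies in $[f_{\min}-\varepsilon,\,f_{\max}+\varepsilon]$. (2) Suppose that $f$ has no zero on the unit circle. Then for every $\varepsilon>0$ there are $k,n_1\in\mathbb N$ such that, for every $n\ge n_1$, the matrix $G_n(f)$ is invertible and the number of eigenvalues $\lambda$ of $G_n(f)^{-1}T_n(f)$ (counted with algebraic multiplicity) with $|\lambda-1|>\varepsilon$ is less than $k$; that is, the spectrum of $G_n(f)^{-1}T_n(f)$ is clustered around $1$. -/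

import Mathlib

/-- The orthogonal matrix `Q_n` of cosine and sine columns, with indices `k, j = 0, …, n - 1`:
column `j ≤ ⌊n/2⌋` is `α_j cos (2 π k j / n)`, column `j > ⌊n/2⌋` is
`α_j sin (2 π k (n - j) / n)`, where `α_j = 1 / √n` if `j = 0` or `2 j = n`, and
`α_j = √(2 / n)` otherwise. -/
noncomputable def gammaQ (n : ℕ) : Matrix (Fin n) (Fin n) ℝ :=
  Matrix.of fun k j =>
    (if (j : ℕ) = 0 ∨ 2 * (j : ℕ) = n then 1 / Real.sqrt (n : ℝ) else Real.sqrt (2 / (n : ℝ))) *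
      (if (j : ℕ) ≤ n / 2 then Real.cos (2 * Real.pi * ((k : ℕ) : ℝ) * ((j : ℕ) : ℝ) / (n : ℝ))
        else Real.sin (2 * Real.pi * ((k : ℕ) : ℝ) * ((n : ℝ) - ((j : ℕ) : ℝ)) / (n : ℝ)))

/-- The index `(n - j) mod n`. -/
def reflectIndex {n : ℕ} (j : Fin n) : Fin n :=
  ⟨(n - (j : ℕ)) % n, Nat.mod_lt _ (Nat.lt_of_le_of_lt (Nat.zero_le _) j.isLt)⟩

/-- Symmetric vectors: `v_j = v_{n - j}`, indices modulo `n`. -/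
def IsSymmVec {n : ℕ} (v : Fin n → ℝ) : Prop := ∀ j, v j = v (reflectIndex j)

/-- Asymmetric vectors: `v_j = - v_{n - j}`, indices modulo `n`. -/
def IsAsymmVec {n : ℕ} (v : Fin n → ℝ) : Prop := ∀ j, v j = -v (reflectIndex j)

/-- The class `𝒢_n` of `γ`-matrices: the real matrices diagonalized by `Q_n`. -/
def gammaMatrices (n : ℕ) : Set (Matrix (Fin n) (Fin n) ℝ) :=
  {G | ∃ v : Fin n → ℝ, G = gammaQ n * Matrix.diagonal v * (gammaQ n).transpose}

/-- The class `𝒞_n`: `γ`-matrices with a symmetric vector of eigenvalues. -/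
def gammaSymm (n : ℕ) : Set (Matrix (Fin n) (Fin n) ℝ) :=
  {G | ∃ v : Fin n → ℝ, IsSymmVec v ∧
    G = gammaQ n * Matrix.diagonal v * (gammaQ n).transpose}

/-- The class `ℬ_n`: `γ`-matrices with an asymmetric vector of eigenvalues. -/
def gammaAsymm (n : ℕ) : Set (Matrix (Fin n) (Fin n) ℝ) :=
  {G | ∃ v : Fin n → ℝ, IsAsymmVec v ∧
    G = gammaQ n * Matrix.diagonal v * (gammaQ n).transpose}

section Frobenius

attribute [local instance] Matrix.frobeniusNormedAddCommGroup Matrix.frobeniusNormedSpace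

/-- `G` is a `γ`-matrix at minimal Frobenius distance from `T`. -/
def IsOptimalGamma {n : ℕ} (T G : Matrix (Fin n) (Fin n) ℝ) : Prop :=
  G ∈ gammaMatrices n ∧ ∀ G' ∈ gammaMatrices n, ‖G - T‖ ≤ ‖G' - T‖

/-- Every matrix has an optimal `γ`-approximation. -/
theorem exists_isOptimalGamma {n : ℕ} (T : Matrix (Fin n) (Fin n) ℝ) :
    ∃ G, IsOptimalGamma T G := by
  let L : (Fin n → ℝ) →ₗ[ℝ] Matrix (Fin n) (Fin n) ℝ :=
    { toFun := fun v => gammaQ n * Matrix.diagonal v * (gammaQ n).transpose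
      map_add' := fun v w => by
        rw [← Matrix.add_mul, ← Matrix.mul_add, Matrix.diagonal_add]
        rfl
      map_smul' := fun c v => by
        rw [RingHom.id_apply, ← Matrix.smul_mul, ← Matrix.mul_smul, ← Matrix.diagonal_smul] }
  have hL : (LinearMap.range L : Set (Matrix (Fin n) (Fin n) ℝ)) = gammaMatrices n := by
    ext G
    constructor
    · rintro ⟨v, rfl⟩
      exact ⟨v, rfl⟩
    · rintro ⟨v, rfl⟩
      exact ⟨v, rfl⟩
  have : ProperSpace (Matrix (Fin n) (Fin n) ℝ) := FiniteDimensional.proper ℝ _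
  have hc := (LinearMap.range L).closed_of_finiteDimensional
  obtain ⟨G, hG, hd⟩ := hc.exists_infDist_eq_dist ⟨0, (LinearMap.range L).zero_mem⟩ T
  refine ⟨G, hL ▸ hG, fun G' hG' => ?_⟩
  have h1 := Metric.infDist_le_dist_of_mem (x := T) (show G' ∈ (LinearMap.range L :
    Set (Matrix (Fin n) (Fin n) ℝ)) from hL ▸ hG')
  rw [hd, dist_comm, dist_comm T G', dist_eq_norm, dist_eq_norm] at h1
  exact h1

/-- The optimal `γ`-approximation is unique. -/
theorem IsOptimalGamma.unique {n : ℕ} {T G H : Matrix (Fin n) (Fin n) ℝ}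
    (hG : IsOptimalGamma T G) (hH : IsOptimalGamma T H) : G = H := by
  have hsq : ∀ A : Matrix (Fin n) (Fin n) ℝ, ‖A‖ ^ 2 = ∑ i, ∑ j, A i j ^ 2 := by
    intro A
    rw [Matrix.frobenius_norm_def, ← Real.sqrt_eq_rpow, Real.sq_sqrt (by positivity)]
    simp
  have hM : (1 / 2 : ℝ) • (G + H) ∈ gammaMatrices n := by
    obtain ⟨v, rfl⟩ := hG.1
    obtain ⟨w, rfl⟩ := hH.1
    refine ⟨(1 / 2 : ℝ) • (v + w), ?_⟩
    rw [← Matrix.add_mul, ← Matrix.mul_add, Matrix.diagonal_add, ← Matrix.smul_mul,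
      ← Matrix.mul_smul, ← Matrix.diagonal_smul]
    rfl
  have h1 := pow_le_pow_left₀ (norm_nonneg _) (hG.2 _ hM) 2
  have h2 := pow_le_pow_left₀ (norm_nonneg _) (hH.2 _ hM) 2
  rw [hsq, hsq] at h1 h2
  have key : (∑ i, ∑ j, (G i j - H i j) ^ 2) = 2 * (∑ i, ∑ j, (G - T) i j ^ 2)
      + 2 * (∑ i, ∑ j, (H - T) i j ^ 2)
      - 4 * (∑ i, ∑ j, ((1 / 2 : ℝ) • (G + H) - T) i j ^ 2) := by
    simp only [Finset.mul_sum, ← Finset.sum_add_distrib, ← Finset.sum_sub_distrib,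
      Matrix.sub_apply, Matrix.smul_apply, Matrix.add_apply, smul_eq_mul]
    refine Finset.sum_congr rfl fun i _ => Finset.sum_congr rfl fun j _ => ?_
    ring
  have h0 : (∑ i, ∑ j, (G i j - H i j) ^ 2) = 0 :=
    le_antisymm (by linarith) (by positivity)
  ext i j
  have h3 := (Finset.sum_eq_zero_iff_of_nonneg (fun i _ => by positivity)).1 h0 i
    (Finset.mem_univ i)
  have h4 := (Finset.sum_eq_zero_iff_of_nonneg (fun j _ => by positivity)).1 h3 j
    (Finset.mem_univ j)
  exact sub_eq_zero.1 (pow_eq_zero_iff (two_ne_zero) |>.1 h4)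

end Frobenius

/-- `reflectIndex` is an involution. -/
theorem reflectIndex_reflectIndex {n : ℕ} (j : Fin n) : reflectIndex (reflectIndex j) = j := by
  apply Fin.ext
  have hj := j.isLt
  simp only [reflectIndex]
  rcases Nat.eq_zero_or_pos (j : ℕ) with h | h
  · simp [h]
  · rw [Nat.mod_eq_of_lt (a := n - (j : ℕ)) (by omega), Nat.mod_eq_of_lt (by omega)]
    omega

/-- Every `γ`-matrix is the sum of a matrix of `𝒞_n` and a matrix of `ℬ_n`. -/
theorem exists_gammaSymm_add_gammaAsymm {n : ℕ} {G : Matrix (Fin n) (Fin n) ℝ}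
    (hG : G ∈ gammaMatrices n) :
    ∃ C B : Matrix (Fin n) (Fin n) ℝ, C ∈ gammaSymm n ∧ B ∈ gammaAsymm n ∧ C + B = G := by
  obtain ⟨v, rfl⟩ := hG
  refine ⟨_, _, ⟨fun j => (v j + v (reflectIndex j)) / 2, fun j => ?_, rfl⟩,
    ⟨fun j => (v j - v (reflectIndex j)) / 2, fun j => ?_, rfl⟩, ?_⟩
  · simp only [reflectIndex_reflectIndex]
    ring
  · simp only [reflectIndex_reflectIndex]
    ring
  · rw [← Matrix.add_mul, ← Matrix.mul_add, Matrix.diagonal_add]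
    congr 3
    funext j
    ring

/-- Existence of the optimal pair `C_n(T) ∈ 𝒞_n`, `B_n(T) ∈ ℬ_n`. -/
theorem exists_optimalPair {n : ℕ} (T : Matrix (Fin n) (Fin n) ℝ) :
    ∃ P : Matrix (Fin n) (Fin n) ℝ × Matrix (Fin n) (Fin n) ℝ,
      P.1 ∈ gammaSymm n ∧ P.2 ∈ gammaAsymm n ∧ IsOptimalGamma T (P.1 + P.2) := by
  obtain ⟨G, hG⟩ := exists_isOptimalGamma T
  obtain ⟨C, B, hC, hB, rfl⟩ := exists_gammaSymm_add_gammaAsymm hG.1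
  exact ⟨(C, B), hC, hB, hG⟩

/-- The component `C_n(T) ∈ 𝒞_n` of the optimal `γ`-approximation of `T`. -/
noncomputable def optC {n : ℕ} (T : Matrix (Fin n) (Fin n) ℝ) : Matrix (Fin n) (Fin n) ℝ :=
  (exists_optimalPair T).choose.1

/-- The component `B_n(T) ∈ ℬ_n` of the optimal `γ`-approximation of `T`. -/
noncomputable def optB {n : ℕ} (T : Matrix (Fin n) (Fin n) ℝ) : Matrix (Fin n) (Fin n) ℝ :=
  (exists_optimalPair T).choose.2

/-- The optimal `γ`-approximation `G_n(T) = C_n(T) + B_n(T)` of `T`. -/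
noncomputable def optG {n : ℕ} (T : Matrix (Fin n) (Fin n) ℝ) : Matrix (Fin n) (Fin n) ℝ :=
  optC T + optB T

/-- The defining properties of `C_n(T)`, `B_n(T)` and `G_n(T)`. -/
theorem optG_spec {n : ℕ} (T : Matrix (Fin n) (Fin n) ℝ) :
    optC T ∈ gammaSymm n ∧ optB T ∈ gammaAsymm n ∧ IsOptimalGamma T (optG T) :=
  (exists_optimalPair T).choose_spec

/-- `f` is the function of the Wiener class, on the unit circle, with the real coefficients
`t_j = t_{-j}`, that is `f(z) = ∑ t_j z ^ j` over all integers `j`, with `∑ |t_j| < ∞`. -/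
structure IsWienerSymbol (f : Circle → ℝ) (t : ℤ → ℝ) : Prop where
  symm : ∀ j, t (-j) = t j
  summable : Summable fun j => |t j|
  hasSum : ∀ z : Circle, HasSum (fun j : ℤ => (t j : ℂ) * (z : ℂ) ^ j) (f z : ℂ)

/-- The real symmetric Toeplitz matrix `(t_{|k - j|})`, `k, j = 0, …, n - 1`. -/
def toeplitzMatrix (t : ℤ → ℝ) (n : ℕ) : Matrix (Fin n) (Fin n) ℝ :=
  Matrix.of fun k j => t |((k : ℕ) : ℤ) - ((j : ℕ) : ℤ)|

/-- The number of complex eigenvalues `μ` of the real matrix `A`, counted with algebraic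
multiplicity, such that `|μ - 1| > ε`. -/
noncomputable def numEigenvaluesFarFromOne {n : ℕ} (A : Matrix (Fin n) (Fin n) ℝ) (ε : ℝ) : ℕ :=
  open scoped Classical in
  Multiset.countP (fun μ : ℂ => ε < ‖μ - 1‖) (A.map (algebraMap ℝ ℂ)).charpoly.roots

/-! Let `q_j` be the columns of the orthogonal matrix `Q = gammaQ n`. Conjugation by `Q` preserves
the Frobenius norm, so the best `γ`-approximation `G` of `T` keeps exactly the diagonal of `Qᵀ T Q`:
its eigenvalues are the Rayleigh quotients `q_jᵀ T q_j` (`optG_eq`). The form `xᵀ T x` is the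
integral of `f |p|²`, where `p` is the trigonometric polynomial with coefficients `x`
(`IsWienerSymbol.le_form`), so these quotients lie between the minimum and the maximum of `f`. Part
(1) thus holds for every `n ≥ 1`, even without `ε`.

For part (2), `f` has constant sign, and passing to `-f` if necessary gives `f ≥ m > 0`, hence `G ≥
m` as a form. Cut the coefficients at `N`. The discarded part of `T` is a small form by the Schur
test. The banded part `P` differs from a symmetric circulant `C` only in the first and last `N`
rows, and `C` is itself a `γ`-matrix. So `C - G` is a `γ`-matrix with eigenvalues `q_jᵀ (C - T)
q_j`; these are small because the entries of `C - P` have a total size bounded in `n`, while those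
of `q_j` are `O(n^{-1/2})`.

Hence `|xᵀ (T - G) x| ≤ ε m |x|² ≤ ε xᵀ G x` for all `x` vanishing at the corner coordinates
(`abs_form_toeplitz_sub_optG_le`), and a Courant–Fischer count (`numEigenvaluesFarFromOne_le`)
leaves at most `4 N` eigenvalues of `G⁻¹ T` farther than `ε` from `1`. -/

section

open Matrix

/-! ### Matrix pencils and eigenvalue counting -/

/-- A symmetric matrix and a positive definite matrix are simultaneously diagonalized by a
congruence; the positive definite matrix is given by an orthogonal diagonalization. -/
theorem exists_simultaneous_diagonalization {ι : Type*} [Fintype ι] [DecidableEq ι]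
    {Q T : Matrix ι ι ℝ} {v : ι → ℝ} (hQ : Qᵀ * Q = 1) (hv : ∀ i, 0 < v i) (hT : Tᵀ = T) :
    ∃ (W : Matrix ι ι ℝ) (d : ι → ℝ), Wᵀ * (Q * diagonal v * Qᵀ) * W = 1 ∧
      Wᵀ * T * W = diagonal d := by
  -- The substitution `Q * D` turns the positive definite form into the Euclidean one; an orthogonal
  -- eigenbasis `U` of the transformed `T` then leaves it Euclidean.
  set D : Matrix ι ι ℝ := diagonal fun i => (Real.sqrt (v i))⁻¹ with hD
  have hDt : Dᵀ = D := diagonal_transpose _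
  have hDD : D * diagonal v * D = 1 := by
    rw [hD, diagonal_mul_diagonal, diagonal_mul_diagonal, ← diagonal_one]
    congr 1
    funext i
    have h := (Real.sqrt_pos.2 (hv i)).ne'
    field_simp
    rw [Real.sq_sqrt (hv i).le]
  have hM : ((Q * D)ᵀ * T * (Q * D)).IsHermitian := by
    rw [IsHermitian, conjTranspose_eq_transpose_of_trivial]
    simp only [transpose_mul, transpose_transpose, hT, Matrix.mul_assoc]
  set U : Matrix ι ι ℝ := (hM.eigenvectorUnitary : Matrix ι ι ℝ) with hU
  have hUU : Uᵀ * U = 1 := by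
    have := Unitary.coe_star_mul_self hM.eigenvectorUnitary
    rwa [star_eq_conjTranspose, conjTranspose_eq_transpose_of_trivial] at this
  have hspec : Uᵀ * ((Q * D)ᵀ * T * (Q * D)) * U = diagonal hM.eigenvalues := by
    have := hM.conjStarAlgAut_star_eigenvectorUnitary
    rw [Unitary.conjStarAlgAut_star_apply, star_eq_conjTranspose,
      conjTranspose_eq_transpose_of_trivial] at this
    exact this
  refine ⟨Q * D * U, hM.eigenvalues, ?_, ?_⟩
  · calc (Q * D * U)ᵀ * (Q * diagonal v * Qᵀ) * (Q * D * U)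
        = Uᵀ * (Dᵀ * ((Qᵀ * Q) * diagonal v * (Qᵀ * Q)) * D) * U := by
          simp only [transpose_mul, Matrix.mul_assoc]
      _ = 1 := by rw [hQ, Matrix.one_mul, Matrix.mul_one, hDt, hDD, Matrix.mul_one, hUU]
  · rw [← hspec]
    simp only [transpose_mul, Matrix.mul_assoc]

/-- If `Wᵀ G W = 1` and `Wᵀ T W` is diagonal, then `G⁻¹ T` has the diagonal entries as its
eigenvalues, with multiplicities. -/
theorem charpoly_inv_mul_of_congruence {ι : Type*} [Fintype ι] [DecidableEq ι]
    {G T W : Matrix ι ι ℝ} {d : ι → ℝ} (hG : Wᵀ * G * W = 1) (hT : Wᵀ * T * W = diagonal d) :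
    (G⁻¹ * T).charpoly = ∏ i, (Polynomial.X - Polynomial.C (d i)) := by
  have h1 : W * (Wᵀ * G) = 1 := mul_eq_one_comm.1 hG
  have h2 : G⁻¹ = W * Wᵀ := inv_eq_left_inv (by rw [Matrix.mul_assoc, h1])
  -- `W (Wᵀ T)` and `(Wᵀ T) W` have the same characteristic polynomial.
  rw [h2, Matrix.mul_assoc, Matrix.charpoly_mul_comm, hT, charpoly_diagonal]

theorem numEigenvaluesFarFromOne_of_congruence {n : ℕ} {G T W : Matrix (Fin n) (Fin n) ℝ}
    {d : Fin n → ℝ} (hG : Wᵀ * G * W = 1) (hT : Wᵀ * T * W = diagonal d) (ε : ℝ) :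
    numEigenvaluesFarFromOne (G⁻¹ * T) ε = (Finset.univ.filter fun i => ε < |d i - 1|).card := by
  classical
  have h : ((G⁻¹ * T).map (algebraMap ℝ ℂ)).charpoly.roots
      = Finset.univ.val.map fun i => (d i : ℂ) := by
    rw [charpoly_map, charpoly_inv_mul_of_congruence hG hT, Polynomial.map_prod]
    simp only [Polynomial.map_sub, Polynomial.map_X, Polynomial.map_C]
    have := Polynomial.roots_multiset_prod_X_sub_C (Finset.univ.val.map fun i => (d i : ℂ))
    rwa [Multiset.map_map] at this
  rw [numEigenvaluesFarFromOne, h, Multiset.countP_map, Finset.card_def, Finset.filter_val]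
  congr 2
  funext i
  rw [← Complex.ofReal_one, ← Complex.ofReal_sub, Complex.norm_real, Real.norm_eq_abs]

/-- Courant–Fischer counting: a diagonal quadratic form which is at most `a` times the Euclidean
one on the kernel of a map to `κ → ℝ` has at most `card κ` coefficients exceeding `a`. -/
theorem card_filter_lt_le_of_form_le {ι κ : Type*} [Fintype ι] [Fintype κ]
    {d : ι → ℝ} {a : ℝ} (L : (ι → ℝ) →ₗ[ℝ] (κ → ℝ))
    (h : ∀ c : ι → ℝ, L c = 0 → ∑ i, d i * c i ^ 2 ≤ a * ∑ i, c i ^ 2) :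
    (Finset.univ.filter fun i => a < d i).card ≤ Fintype.card κ := by
  classical
  by_contra! hlt
  set s := Finset.univ.filter fun i => a < d i with hs
  let E : (s → ℝ) →ₗ[ℝ] (ι → ℝ) := Function.ExtendByZero.linearMap ℝ (Subtype.val : s → ι)
  have hE : ∀ (c : s → ℝ) (i : s), E c i = c i := fun c i =>
    Subtype.val_injective.extend_apply c (0 : ι → ℝ) i
  have hE0 : ∀ (c : s → ℝ) (i : ι), i ∉ s → E c i = 0 := fun c i hi =>
    Function.extend_apply' c (0 : ι → ℝ) i fun ⟨j, hj⟩ => hi (hj ▸ j.2)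
  -- If `s` has more than `card κ` elements, some nonzero vector supported on `s` is killed by `L`;
  -- on it the form strictly exceeds `a` times the Euclidean one.
  have hker : LinearMap.ker (L ∘ₗ E) ≠ ⊥ := LinearMap.ker_ne_bot_of_finrank_lt (by simpa using hlt)
  obtain ⟨c, hc, hc0⟩ := (Submodule.ne_bot_iff _).1 hker
  obtain ⟨j, hj⟩ := Function.ne_iff.1 hc0
  refine absurd (h (E c) hc) (not_le.2 ?_)
  rw [Finset.mul_sum]
  refine Finset.sum_lt_sum (fun i _ => ?_) ⟨j, Finset.mem_univ _, ?_⟩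
  · by_cases hi : i ∈ s
    · exact mul_le_mul_of_nonneg_right (Finset.mem_filter.1 hi).2.le (sq_nonneg _)
    · simp [hE0 c i hi]
  · refine mul_lt_mul_of_pos_right (Finset.mem_filter.1 j.2).2 ?_
    rw [hE]
    exact sq_pos_of_ne_zero (by simpa using hj)

/-- If `T - G` is a form bounded by `ε G` on the kernel of a map to `κ → ℝ`, then all but at most
`2 card κ` eigenvalues of `G⁻¹ T` are within `ε` of `1`. -/
theorem numEigenvaluesFarFromOne_le {n : ℕ} {κ : Type*} [Fintype κ]
    {Q T : Matrix (Fin n) (Fin n) ℝ} {v : Fin n → ℝ} (hQ : Qᵀ * Q = 1) (hv : ∀ i, 0 < v i)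
    (hT : Tᵀ = T) {ε : ℝ} (L : (Fin n → ℝ) →ₗ[ℝ] (κ → ℝ))
    (h : ∀ x, L x = 0 → |x ⬝ᵥ ((T - Q * diagonal v * Qᵀ) *ᵥ x)| ≤
      ε * (x ⬝ᵥ ((Q * diagonal v * Qᵀ) *ᵥ x))) :
    numEigenvaluesFarFromOne ((Q * diagonal v * Qᵀ)⁻¹ * T) ε ≤ 2 * Fintype.card κ := by
  obtain ⟨W, d, hGW, hTW⟩ := exists_simultaneous_diagonalization hQ hv hT
  rw [numEigenvaluesFarFromOne_of_congruence hGW hTW]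
  have hform : ∀ (A : Matrix (Fin n) (Fin n) ℝ) (c : Fin n → ℝ),
      (W *ᵥ c) ⬝ᵥ (A *ᵥ (W *ᵥ c)) = c ⬝ᵥ ((Wᵀ * A * W) *ᵥ c) := by
    intro A c
    rw [← mulVec_mulVec, ← mulVec_mulVec, dotProduct_mulVec c, vecMul_transpose]
  have hc : ∀ c, (L ∘ₗ W.mulVecLin) c = 0 →
      |∑ i, (d i - 1) * c i ^ 2| ≤ ε * ∑ i, c i ^ 2 := by
    intro c hc
    have := h (W *ᵥ c) hc
    rw [hform, hform, Matrix.mul_sub, Matrix.sub_mul, hGW, hTW, one_mulVec, ← diagonal_one,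
      diagonal_sub] at this
    convert this using 2
    · simp only [dotProduct, mulVec_diagonal]
      refine Finset.sum_congr rfl fun i _ => ?_
      ring
    · simp only [dotProduct]
      congr 1
      funext i
      ring
  -- Deviations of `d i` above and below `1` are counted separately, each with the constraints
  -- pulled back by `W`; hence the factor `2`.
  have h1 := card_filter_lt_le_of_form_le (d := fun i => d i - 1) (a := ε) (L ∘ₗ W.mulVecLin)
    fun c hcL => (le_abs_self _).trans (hc c hcL)
  have h2 := card_filter_lt_le_of_form_le (d := fun i => -(d i - 1)) (a := ε) (L ∘ₗ W.mulVecLin)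
    fun c hcL => by
      simp only [neg_mul, Finset.sum_neg_distrib]
      exact (neg_le_abs _).trans (hc c hcL)
  have h3 : (Finset.univ.filter fun i => ε < |d i - 1|) =
      (Finset.univ.filter fun i => ε < d i - 1) ∪ Finset.univ.filter fun i => ε < -(d i - 1) := by
    ext i
    simp [lt_abs]
  rw [h3]
  exact (Finset.card_union_le _ _).trans (by omega)

/-! ### Toeplitz forms as integrals over the circle -/

section CircleForm

open MeasureTheory

/-- The integral of continuous functions on `ℝ / ℤ`, as a continuous linear map. -/
noncomputable def haarIntegral : C(UnitAddCircle, ℂ) →L[ℂ] ℂ :=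
  LinearMap.mkContinuous
    { toFun := fun g => ∫ y, g y ∂AddCircle.haarAddCircle
      map_add' := fun g h => integral_add
        (g.continuous.integrable_of_hasCompactSupport (HasCompactSupport.of_compactSpace _))
        (h.continuous.integrable_of_hasCompactSupport (HasCompactSupport.of_compactSpace _))
      map_smul' := fun c g => integral_smul c g } 1 fun g => by
    rw [one_mul]
    refine (norm_integral_le_of_norm_le_const
      (ae_of_all _ fun x => g.norm_coe_le_norm x)).trans ?_
    simp

theorem haarIntegral_fourier (j : ℤ) : haarIntegral (fourier j) = if j = 0 then 1 else 0 := by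
  have h : haarIntegral (fourier j) = fourierCoeff (fourier j : C(UnitAddCircle, ℂ)) 0 := by
    simp [haarIntegral, fourierCoeff]
  rw [h, fourierCoeff_fourier]
  rcases eq_or_ne j 0 with rfl | h
  · simp
  · simp [h, Ne.symm h]

theorem haarIntegral_ofReal_nonneg {g : C(UnitAddCircle, ℂ)} {u : UnitAddCircle → ℝ}
    (hu : ∀ y, 0 ≤ u y) (hg : ∀ y, g y = (u y : ℂ)) : 0 ≤ (haarIntegral g).re := by
  have h : haarIntegral g = ((∫ y, u y ∂AddCircle.haarAddCircle : ℝ) : ℂ) := by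
    rw [← integral_complex_ofReal]
    exact integral_congr_ae (ae_of_all _ hg)
  rw [h, Complex.ofReal_re]
  exact integral_nonneg hu

/-- The continuous function on `ℝ / ℤ` with the absolutely summable Fourier coefficients `t`. -/
theorem IsWienerSymbol.exists_continuousMap {f : Circle → ℝ} {t : ℤ → ℝ}
    (hf : IsWienerSymbol f t) :
    ∃ F : C(UnitAddCircle, ℂ), (∀ x : UnitAddCircle, F x = (f x.toCircle : ℂ)) ∧
      ∀ j, haarIntegral (fourier (-j) * F) = (t j : ℂ) := by
  -- The characters have sup norm `1`, so the series converges in `C(UnitAddCircle, ℂ)`, and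
  -- evaluation and integration act term by term.
  have hs : Summable fun j : ℤ => (t j : ℂ) • (fourier j : C(UnitAddCircle, ℂ)) := by
    refine Summable.of_norm ?_
    simpa [norm_smul, fourier_norm] using hf.summable
  refine ⟨∑' j, (t j : ℂ) • fourier j, fun x => ?_, fun j => ?_⟩
  · have h1 := (ContinuousMap.evalCLM ℂ x).hasSum hs.hasSum
    refine h1.unique ?_
    have h2 := hf.hasSum x.toCircle
    convert h2 using 2 with j
    simp [fourier_apply, AddCircle.toCircle_zsmul]
  · have h1 := haarIntegral.hasSum (hs.hasSum.mul_left (fourier (-j)))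
    refine h1.unique ?_
    have h2 : ∀ i : ℤ, haarIntegral (fourier (-j) * (t i : ℂ) • fourier i)
        = if i = j then (t j : ℂ) else 0 := by
      intro i
      have h3 : (fourier (-j) * fourier i : C(UnitAddCircle, ℂ)) = fourier (-j + i) := by
        ext y
        rw [fourier_add]
        rfl
      rw [mul_smul_comm, map_smul, h3, haarIntegral_fourier]
      rcases eq_or_ne i j with rfl | h
      · simp
      · rw [if_neg (by omega), if_neg h, smul_zero]
    simp only [h2]
    exact hasSum_ite_eq j _

theorem IsWienerSymbol.apply_abs {f : Circle → ℝ} {t : ℤ → ℝ} (hf : IsWienerSymbol f t) (j : ℤ) :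
    t |j| = t j := by
  rcases abs_choice j with h | h <;> rw [h]
  exact hf.symm _

/-- A symbol of the Wiener class is continuous. -/
theorem IsWienerSymbol.continuous {f : Circle → ℝ} {t : ℤ → ℝ} (hf : IsWienerSymbol f t) :
    Continuous f := by
  have h : Continuous fun z : Circle => ∑' j : ℤ, (t j : ℂ) * (z : ℂ) ^ j := by
    refine continuous_tsum (fun j => ?_) hf.summable fun j z => by
      rw [norm_mul, norm_zpow, Circle.norm_coe, _root_.one_zpow, mul_one, Complex.norm_real,
        Real.norm_eq_abs]
    simp only [← Circle.coe_zpow]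
    exact continuous_const.mul (continuous_induced_dom.comp (continuous_zpow (G := Circle) j))
  have h2 : f = fun z : Circle => (∑' j : ℤ, (t j : ℂ) * (z : ℂ) ^ j).re := by
    funext z
    rw [(hf.hasSum z).tsum_eq, Complex.ofReal_re]
  rw [h2]
  exact Complex.continuous_re.comp h

/-- The quadratic form of a Toeplitz matrix is at least the minimum of the symbol. -/
theorem IsWienerSymbol.le_form {f : Circle → ℝ} {t : ℤ → ℝ} (hf : IsWienerSymbol f t) {a : ℝ}
    (ha : ∀ z, a ≤ f z) {n : ℕ} (x : Fin n → ℝ) :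
    a * (x ⬝ᵥ x) ≤ x ⬝ᵥ (toeplitzMatrix t n *ᵥ x) := by
  obtain ⟨F, hF, hFt⟩ := hf.exists_continuousMap
  -- `p` is `|∑ x_k e_k|²` multiplied out: its integral against `F` is the Toeplitz form, and its
  -- integral against `1` is `x ⬝ᵥ x`.
  let p : C(UnitAddCircle, ℂ) :=
    ∑ k : Fin n, ∑ l : Fin n, ((x k * x l : ℝ) : ℂ) • fourier (-((k : ℤ) - (l : ℤ)))
  have hp : ∀ y, p y
      = ((‖∑ k : Fin n, (x k : ℂ) * fourier (k : ℤ) y‖ ^ 2 : ℝ) : ℂ) := by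
    intro y
    push_cast
    rw [← Complex.conj_mul']
    simp only [p, ContinuousMap.coe_sum, Finset.sum_apply, ContinuousMap.coe_smul, Pi.smul_apply,
      map_sum, Finset.sum_mul_sum, smul_eq_mul, map_mul, Complex.conj_ofReal, ← fourier_neg]
    refine Finset.sum_congr rfl fun k _ => Finset.sum_congr rfl fun l _ => ?_
    rw [neg_sub, sub_eq_neg_add, fourier_add]
    push_cast
    ring
  have hcoef : ∀ g : C(UnitAddCircle, ℂ), haarIntegral (p * g) = ∑ k : Fin n, ∑ l : Fin n,
      ((x k * x l : ℝ) : ℂ) * haarIntegral (fourier (-((k : ℤ) - (l : ℤ))) * g) := by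
    intro g
    simp only [p, Finset.sum_mul, smul_mul_assoc, map_sum, map_smul, smul_eq_mul]
  have hpF : haarIntegral (p * F) = ((x ⬝ᵥ (toeplitzMatrix t n *ᵥ x) : ℝ) : ℂ) := by
    rw [hcoef]
    simp only [dotProduct, mulVec, hFt, toeplitzMatrix, Matrix.of_apply, Complex.ofReal_sum,
      Finset.mul_sum]
    refine Finset.sum_congr rfl fun k _ => Finset.sum_congr rfl fun l _ => ?_
    rw [hf.apply_abs]
    push_cast
    ring
  have hp1 : haarIntegral p = ((x ⬝ᵥ x : ℝ) : ℂ) := by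
    rw [← mul_one p, hcoef]
    simp only [dotProduct, mul_one, haarIntegral_fourier, Complex.ofReal_sum]
    refine Finset.sum_congr rfl fun k _ => ?_
    rw [Finset.sum_eq_single k]
    · simp
    · intro l _ hl
      have := Fin.val_ne_of_ne hl
      rw [if_neg (by omega), mul_zero]
    · simp
  have h := haarIntegral_ofReal_nonneg (g := p * F - (a : ℂ) • p)
    (u := fun y => ‖∑ k : Fin n, (x k : ℂ) * fourier (k : ℤ) y‖ ^ 2 * (f y.toCircle - a))
    (fun y => mul_nonneg (sq_nonneg _) (sub_nonneg.2 (ha _))) fun y => by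
      rw [ContinuousMap.sub_apply, ContinuousMap.mul_apply, ContinuousMap.smul_apply, hF, hp,
        smul_eq_mul]
      push_cast
      ring
  rw [map_sub, map_smul, hpF, hp1, smul_eq_mul, ← Complex.ofReal_mul, ← Complex.ofReal_sub,
    Complex.ofReal_re] at h
  linarith

theorem IsWienerSymbol.neg {f : Circle → ℝ} {t : ℤ → ℝ} (hf : IsWienerSymbol f t) :
    IsWienerSymbol (fun z => -f z) fun j => -t j where
  symm j := by rw [hf.symm]
  summable := by simpa using hf.summable
  hasSum z := by simpa using (hf.hasSum z).neg

theorem toeplitzMatrix_neg (t : ℤ → ℝ) (n : ℕ) :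
    toeplitzMatrix (fun j => -t j) n = -toeplitzMatrix t n := rfl

/-- The quadratic form of a Toeplitz matrix is at most the maximum of the symbol. -/
theorem IsWienerSymbol.form_le {f : Circle → ℝ} {t : ℤ → ℝ} (hf : IsWienerSymbol f t) {b : ℝ}
    (hb : ∀ z, f z ≤ b) {n : ℕ} (x : Fin n → ℝ) :
    x ⬝ᵥ (toeplitzMatrix t n *ᵥ x) ≤ b * (x ⬝ᵥ x) := by
  have := hf.neg.le_form (a := -b) (fun z => neg_le_neg (hb z)) x
  rw [toeplitzMatrix_neg, neg_mulVec, dotProduct_neg] at this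
  linarith

end CircleForm

/-! ### Discrete orthogonality of sines and cosines -/

section TrigSums

theorem sum_exp_two_pi_mul_div {n : ℕ} (hn : 0 < n) (a : ℤ) :
    ∑ k : Fin n, Complex.exp ((2 * Real.pi * ((k : ℕ) : ℝ) * (a : ℝ) / (n : ℝ) : ℝ) * Complex.I)
      = if (n : ℤ) ∣ a then (n : ℂ) else 0 := by
  have hn' : (n : ℂ) ≠ 0 := Nat.cast_ne_zero.2 hn.ne'
  set ζ : ℂ := Complex.exp (2 * Real.pi * Complex.I * a / n) with hζ
  have h1 : ∀ k : ℕ, Complex.exp ((2 * Real.pi * (k : ℝ) * (a : ℝ) / (n : ℝ) : ℝ) * Complex.I)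
      = ζ ^ k := by
    intro k
    rw [hζ, ← Complex.exp_nat_mul]
    congr 1
    push_cast
    ring
  simp only [h1]
  rw [Fin.sum_univ_eq_sum_range fun k => ζ ^ k]
  -- The sum is geometric with ratio an `n`-th root of unity, so it vanishes unless the ratio is
  -- `1`.
  have h2 : ζ = 1 ↔ (n : ℤ) ∣ a := by
    rw [hζ, Complex.exp_eq_one_iff]
    have hpi : (2 * Real.pi * Complex.I : ℂ) ≠ 0 := Complex.two_pi_I_ne_zero
    refine exists_congr fun m => ?_
    rw [mul_div_assoc, mul_comm (m : ℂ), mul_right_inj' hpi, div_eq_iff hn', mul_comm (m : ℂ)]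
    exact_mod_cast Iff.rfl
  split_ifs with h
  · rw [h2.2 h]
    simp
  · have h3 : ζ ^ n = 1 := by
      rw [hζ, ← Complex.exp_nat_mul, Complex.exp_eq_one_iff]
      exact ⟨a, by field_simp⟩
    have h4 := mul_neg_geom_sum ζ n
    rw [h3, sub_self] at h4
    exact (mul_eq_zero.1 h4).resolve_left (sub_ne_zero.2 fun h5 => h (h2.1 h5.symm))

theorem sum_cos_two_pi_mul_div {n : ℕ} (hn : 0 < n) (a : ℤ) :
    ∑ k : Fin n, Real.cos (2 * Real.pi * ((k : ℕ) : ℝ) * (a : ℝ) / (n : ℝ))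
      = if (n : ℤ) ∣ a then (n : ℝ) else 0 := by
  have h := congrArg Complex.re (sum_exp_two_pi_mul_div hn a)
  simp only [Complex.re_sum, Complex.exp_ofReal_mul_I_re] at h
  rw [h]
  split_ifs <;> simp

theorem sum_sin_two_pi_mul_div {n : ℕ} (hn : 0 < n) (a : ℤ) :
    ∑ k : Fin n, Real.sin (2 * Real.pi * ((k : ℕ) : ℝ) * (a : ℝ) / (n : ℝ)) = 0 := by
  have h := congrArg Complex.im (sum_exp_two_pi_mul_div hn a)
  simp only [Complex.im_sum, Complex.exp_ofReal_mul_I_im] at h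
  rw [h]
  split_ifs <;> simp

theorem sum_cos_mul_cos {n : ℕ} (hn : 0 < n) (a b : ℤ) :
    ∑ k : Fin n, Real.cos (2 * Real.pi * ((k : ℕ) : ℝ) * (a : ℝ) / (n : ℝ)) *
        Real.cos (2 * Real.pi * ((k : ℕ) : ℝ) * (b : ℝ) / (n : ℝ))
      = ((if (n : ℤ) ∣ a - b then (n : ℝ) else 0) + if (n : ℤ) ∣ a + b then (n : ℝ) else 0) / 2 := by
  rw [← sum_cos_two_pi_mul_div hn, ← sum_cos_two_pi_mul_div hn, ← Finset.sum_add_distrib,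
    Finset.sum_div]
  refine Finset.sum_congr rfl fun k _ => ?_
  push_cast
  simp only [mul_sub, mul_add, sub_div, add_div, Real.cos_sub, Real.cos_add]
  ring

theorem sum_sin_mul_sin {n : ℕ} (hn : 0 < n) (a b : ℤ) :
    ∑ k : Fin n, Real.sin (2 * Real.pi * ((k : ℕ) : ℝ) * (a : ℝ) / (n : ℝ)) *
        Real.sin (2 * Real.pi * ((k : ℕ) : ℝ) * (b : ℝ) / (n : ℝ))
      = ((if (n : ℤ) ∣ a - b then (n : ℝ) else 0) - if (n : ℤ) ∣ a + b then (n : ℝ) else 0) / 2 := by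
  rw [← sum_cos_two_pi_mul_div hn, ← sum_cos_two_pi_mul_div hn, ← Finset.sum_sub_distrib,
    Finset.sum_div]
  refine Finset.sum_congr rfl fun k _ => ?_
  push_cast
  simp only [mul_sub, mul_add, sub_div, add_div, Real.cos_sub, Real.cos_add]
  ring

theorem sum_sin_mul_cos {n : ℕ} (hn : 0 < n) (a b : ℤ) :
    ∑ k : Fin n, Real.sin (2 * Real.pi * ((k : ℕ) : ℝ) * (a : ℝ) / (n : ℝ)) *
        Real.cos (2 * Real.pi * ((k : ℕ) : ℝ) * (b : ℝ) / (n : ℝ)) = 0 := by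
  have h : (0 : ℝ) =
      (∑ k : Fin n, Real.sin (2 * Real.pi * ((k : ℕ) : ℝ) * ((a - b : ℤ) : ℝ) / (n : ℝ))
      + ∑ k : Fin n, Real.sin (2 * Real.pi * ((k : ℕ) : ℝ) * ((a + b : ℤ) : ℝ) / (n : ℝ))) / 2 := by
    rw [sum_sin_two_pi_mul_div hn, sum_sin_two_pi_mul_div hn]
    simp
  rw [h, ← Finset.sum_add_distrib, Finset.sum_div]
  refine Finset.sum_congr rfl fun k _ => ?_
  push_cast
  simp only [mul_sub, mul_add, sub_div, add_div, Real.sin_sub, Real.sin_add]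
  ring

end TrigSums

/-! ### Orthogonality of `gammaQ` -/

section GammaQ

/-- The frequency of the `j`-th column of `gammaQ n`. -/
def gammaFreq {n : ℕ} (j : Fin n) : ℤ := if (j : ℕ) ≤ n / 2 then (j : ℤ) else n - j

/-- The scaling factor of the `j`-th column of `gammaQ n`. -/
noncomputable def gammaScale {n : ℕ} (j : Fin n) : ℝ :=
  if (j : ℕ) = 0 ∨ 2 * (j : ℕ) = n then 1 / Real.sqrt (n : ℝ) else Real.sqrt (2 / (n : ℝ))

/-- The `j`-th column of `gammaQ n` before scaling, as a function on the integers. -/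
noncomputable def gammaWave {n : ℕ} (j : Fin n) (x : ℤ) : ℝ :=
  if (j : ℕ) ≤ n / 2 then Real.cos (2 * Real.pi * (x : ℝ) * (gammaFreq j : ℝ) / (n : ℝ))
    else Real.sin (2 * Real.pi * (x : ℝ) * (gammaFreq j : ℝ) / (n : ℝ))

theorem gammaQ_apply {n : ℕ} (k j : Fin n) :
    gammaQ n k j = gammaScale j * gammaWave j (k : ℕ) := by
  rw [gammaQ, Matrix.of_apply, gammaScale, gammaWave, gammaFreq]
  split_ifs <;> simp

theorem gammaScale_mul_self {n : ℕ} (j : Fin n) :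
    gammaScale j * gammaScale j = (if (j : ℕ) = 0 ∨ 2 * (j : ℕ) = n then 1 else 2) / n := by
  rw [gammaScale]
  split_ifs
  · rw [div_mul_div_comm, Real.mul_self_sqrt (Nat.cast_nonneg n), one_mul]
  · exact Real.mul_self_sqrt (by positivity)

/-- `Q_n` is orthogonal. -/
theorem gammaQ_transpose_mul_self (n : ℕ) : (gammaQ n)ᵀ * gammaQ n = 1 := by
  ext j l
  have hj := j.isLt
  have hl := l.isLt
  have hn : 0 < n := by omega
  have hn' : (n : ℝ) ≠ 0 := Nat.cast_ne_zero.2 hn.ne'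
  have h0 : ((gammaQ n)ᵀ * gammaQ n) j l =
      gammaScale j * gammaScale l * ∑ k : Fin n, gammaWave j (k : ℕ) * gammaWave l (k : ℕ) := by
    rw [Matrix.mul_apply, Finset.mul_sum]
    refine Finset.sum_congr rfl fun k _ => ?_
    rw [transpose_apply, gammaQ_apply, gammaQ_apply]
    ring
  have hdvd : ∀ a : ℤ, 0 ≤ a → a ≤ n → ((n : ℤ) ∣ a ↔ a = 0 ∨ a = n) := by
    intro a ha0 han
    constructor
    · rintro ⟨c, rfl⟩
      have : c ≤ 1 := by nlinarith
      have : 0 ≤ c := by nlinarith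
      interval_cases c <;> simp
    · rintro (rfl | rfl) <;> simp
  have hdvd' : ∀ a : ℤ, -n < a → a < n → ((n : ℤ) ∣ a ↔ a = 0) := by
    intro a h1 h2
    refine ⟨fun h => Int.eq_zero_of_abs_lt_dvd h (abs_lt.2 ⟨h1, h2⟩), ?_⟩
    rintro rfl
    simp
  -- Frequencies lie in `[0, n / 2]`, so `n` divides a difference only if it is `0`, and a sum only
  -- if it is `0` or `n`.
  have hfreq : ∀ i : Fin n, 0 ≤ gammaFreq i ∧ 2 * gammaFreq i ≤ n := by
    intro i
    have := i.isLt
    rw [gammaFreq]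
    split_ifs <;> constructor <;> omega
  have hdiff : (n : ℤ) ∣ gammaFreq j - gammaFreq l ↔ gammaFreq j - gammaFreq l = 0 :=
    hdvd' _ (by linarith [hfreq j, hfreq l, (Nat.cast_pos (α := ℤ)).2 hn])
      (by linarith [hfreq j, hfreq l, (Nat.cast_pos (α := ℤ)).2 hn])
  have hsum := hdvd (gammaFreq j + gammaFreq l) (by linarith [hfreq j, hfreq l])
    (by linarith [hfreq j, hfreq l])
  rw [h0, Matrix.one_apply]
  by_cases hjc : (j : ℕ) ≤ n / 2 <;> by_cases hlc : (l : ℕ) ≤ n / 2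
  · simp only [gammaWave, if_pos hjc, if_pos hlc, Int.cast_natCast]
    rw [sum_cos_mul_cos hn]
    simp only [hdiff, hsum]
    simp only [gammaFreq, if_pos hjc, if_pos hlc]
    rcases eq_or_ne j l with rfl | hne
    · rw [gammaScale_mul_self, if_pos (sub_self _), if_pos rfl]
      -- For `j = 0` or `2 j = n` both terms of the cosine sum survive and the squared norm is `n`
      -- instead of `n / 2`; this is why `gammaScale` differs there.
      by_cases h : (j : ℕ) = 0 ∨ 2 * (j : ℕ) = n
      · rw [if_pos h, if_pos (by omega)]
        field_simp
        norm_num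
      · rw [if_neg h, if_neg (by omega)]
        field_simp
        norm_num
    · have := Fin.val_ne_of_ne hne
      rw [if_neg (by omega), if_neg (by omega), if_neg hne]
      simp
  · simp only [gammaWave, if_pos hjc, if_neg hlc, Int.cast_natCast]
    simp only [mul_comm (Real.cos _) (Real.sin _)]
    rw [sum_sin_mul_cos hn, mul_zero, if_neg (by rintro rfl; exact hlc hjc)]
  · simp only [gammaWave, if_neg hjc, if_pos hlc, Int.cast_natCast]
    rw [sum_sin_mul_cos hn, mul_zero, if_neg (by rintro rfl; exact hjc hlc)]
  · simp only [gammaWave, if_neg hjc, if_neg hlc, Int.cast_natCast]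
    rw [sum_sin_mul_sin hn]
    simp only [hdiff, hsum]
    simp only [gammaFreq, if_neg hjc, if_neg hlc]
    rcases eq_or_ne j l with rfl | hne
    · rw [gammaScale_mul_self, if_pos (sub_self _), if_pos rfl, if_neg (by omega),
        if_neg (by omega)]
      field_simp
      norm_num
    · have := Fin.val_ne_of_ne hne
      rw [if_neg (by omega), if_neg (by omega), if_neg hne]
      simp

theorem gammaQ_mul_transpose (n : ℕ) : gammaQ n * (gammaQ n)ᵀ = 1 :=
  mul_eq_one_comm.1 (gammaQ_transpose_mul_self n)

/-- The decay `n^{-1/2}` of the entries makes a correction of bounded total size negligible in the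
Rayleigh quotients. -/
theorem abs_gammaQ_le {n : ℕ} (k j : Fin n) : |gammaQ n k j| ≤ Real.sqrt (2 / (n : ℝ)) := by
  rw [gammaQ_apply, abs_mul]
  have h1 : |gammaWave j (k : ℕ)| ≤ 1 := by
    rw [gammaWave]
    split_ifs
    exacts [Real.abs_cos_le_one _, Real.abs_sin_le_one _]
  have h2 : |gammaScale j| ≤ Real.sqrt (2 / (n : ℝ)) := by
    refine Real.abs_le_sqrt ?_
    rw [sq, gammaScale_mul_self]
    gcongr
    split_ifs <;> norm_num
  exact (mul_le_of_le_one_right (abs_nonneg _) h1).trans h2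

end GammaQ

/-! ### The optimal approximation and its eigenvalues -/

section Optimal

/-- The Rayleigh quotients of `T` at the columns of `Q_n`. -/
noncomputable def gammaRayleigh {n : ℕ} (T : Matrix (Fin n) (Fin n) ℝ) (j : Fin n) : ℝ :=
  ((gammaQ n)ᵀ * T * gammaQ n) j j

theorem sum_sq_eq_trace {n : ℕ} (A : Matrix (Fin n) (Fin n) ℝ) :
    ∑ i, ∑ j, A i j ^ 2 = (A * Aᵀ).trace := by
  simp [Matrix.trace, Matrix.mul_apply, sq]

/-- The sum of the squares of the entries is invariant under orthogonal congruence. -/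
theorem sum_sq_congruence {n : ℕ} {Q : Matrix (Fin n) (Fin n) ℝ} (hQ : Q * Qᵀ = 1)
    (A : Matrix (Fin n) (Fin n) ℝ) :
    ∑ i, ∑ j, (Qᵀ * A * Q) i j ^ 2 = ∑ i, ∑ j, A i j ^ 2 := by
  rw [sum_sq_eq_trace, sum_sq_eq_trace]
  have : (Qᵀ * A * Q) * (Qᵀ * A * Q)ᵀ = Qᵀ * (A * (Q * Qᵀ) * Aᵀ * Q) := by
    simp only [transpose_mul, transpose_transpose, Matrix.mul_assoc]
  rw [this, Matrix.trace_mul_comm, hQ, Matrix.mul_one, Matrix.mul_assoc, hQ, Matrix.mul_one]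

section

attribute [local instance] Matrix.frobeniusNormedAddCommGroup

theorem frobenius_norm_eq_sqrt {n : ℕ} (A : Matrix (Fin n) (Fin n) ℝ) :
    ‖A‖ = Real.sqrt (∑ i, ∑ j, A i j ^ 2) := by
  rw [Matrix.frobenius_norm_def, ← Real.sqrt_eq_rpow]
  simp

end

/-- The optimal `γ`-approximation has the Rayleigh quotients at the columns of `Q_n` as its
eigenvalues. -/
theorem optG_eq {n : ℕ} (T : Matrix (Fin n) (Fin n) ℝ) :
    optG T = gammaQ n * diagonal (gammaRayleigh T) * (gammaQ n)ᵀ := by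
  refine (optG_spec T).2.2.unique ⟨⟨_, rfl⟩, ?_⟩
  rintro _ ⟨v, rfl⟩
  rw [frobenius_norm_eq_sqrt, frobenius_norm_eq_sqrt]
  refine Real.sqrt_le_sqrt ?_
  -- After conjugation by `Q` the competitors are `diagonal w - Qᵀ T Q`: the off-diagonal entries do
  -- not depend on `w`, and the Rayleigh quotients annihilate the diagonal.
  rw [← sum_sq_congruence (gammaQ_mul_transpose n), ← sum_sq_congruence (gammaQ_mul_transpose n)
    (gammaQ n * diagonal v * (gammaQ n)ᵀ - T)]
  have h : ∀ w : Fin n → ℝ,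
      (gammaQ n)ᵀ * (gammaQ n * diagonal w * (gammaQ n)ᵀ - T) * gammaQ n
        = diagonal w - (gammaQ n)ᵀ * T * gammaQ n := by
    intro w
    rw [Matrix.mul_sub, Matrix.sub_mul]
    congr 1
    calc (gammaQ n)ᵀ * (gammaQ n * diagonal w * (gammaQ n)ᵀ) * gammaQ n
        = ((gammaQ n)ᵀ * gammaQ n) * diagonal w * ((gammaQ n)ᵀ * gammaQ n) := by
          simp only [Matrix.mul_assoc]
      _ = diagonal w := by rw [gammaQ_transpose_mul_self, Matrix.one_mul, Matrix.mul_one]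
  rw [h, h]
  refine Finset.sum_le_sum fun i _ => Finset.sum_le_sum fun j _ => ?_
  rcases eq_or_ne i j with rfl | hij
  · rw [Matrix.sub_apply, diagonal_apply_eq, gammaRayleigh, sub_self, zero_pow two_ne_zero]
    exact sq_nonneg _
  · rw [Matrix.sub_apply, Matrix.sub_apply, diagonal_apply_ne _ hij, diagonal_apply_ne _ hij]

theorem gammaRayleigh_eq_form {n : ℕ} (T : Matrix (Fin n) (Fin n) ℝ) (j : Fin n) :
    gammaRayleigh T j = (fun k => gammaQ n k j) ⬝ᵥ (T *ᵥ fun k => gammaQ n k j) := by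
  rw [gammaRayleigh, Matrix.mul_assoc]
  rfl

theorem gammaQ_col_dotProduct_self {n : ℕ} (j : Fin n) :
    (fun k => gammaQ n k j) ⬝ᵥ (fun k => gammaQ n k j) = 1 := by
  have := congrFun (congrFun (gammaQ_transpose_mul_self n) j) j
  rwa [Matrix.one_apply_eq] at this

theorem gammaRayleigh_sub {n : ℕ} (S T : Matrix (Fin n) (Fin n) ℝ) (j : Fin n) :
    gammaRayleigh (S - T) j = gammaRayleigh S j - gammaRayleigh T j := by
  rw [gammaRayleigh, Matrix.mul_sub, Matrix.sub_mul]
  rfl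

/-- The eigenvalues of a `γ`-matrix are the entries of its vector. -/
theorem exists_eq_of_hasEigenvalue_gamma {n : ℕ} {v : Fin n → ℝ} {μ : ℝ}
    (h : Module.End.HasEigenvalue
      (Matrix.toLin' (gammaQ n * diagonal v * (gammaQ n)ᵀ)) μ) : ∃ j, v j = μ := by
  obtain ⟨x, hx⟩ := h.exists_hasEigenvector
  have h1 := hx.apply_eq_smul
  rw [Matrix.toLin'_apply] at h1
  have h2 : diagonal v *ᵥ ((gammaQ n)ᵀ *ᵥ x) = μ • ((gammaQ n)ᵀ *ᵥ x) := by
    rw [← mulVec_smul, ← h1, mulVec_mulVec, mulVec_mulVec, Matrix.mul_assoc, ← Matrix.mul_assoc,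
      gammaQ_transpose_mul_self, Matrix.one_mul]
  have h3 : (gammaQ n)ᵀ *ᵥ x ≠ 0 := by
    intro h0
    apply hx.2
    rw [← one_mulVec x, ← gammaQ_mul_transpose, ← mulVec_mulVec, h0, mulVec_zero]
  obtain ⟨j, hj⟩ := Function.ne_iff.1 h3
  refine ⟨j, mul_right_cancel₀ hj ?_⟩
  have := congrFun h2 j
  rwa [mulVec_diagonal] at this

end Optimal

/-! ### Banded Toeplitz matrices and their circulants -/

section Band

/-- The Toeplitz matrix of the coefficients `t m` with `|m| ≤ N`. -/
noncomputable def bandToeplitz (t : ℤ → ℝ) (N n : ℕ) : Matrix (Fin n) (Fin n) ℝ :=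
  Matrix.of fun k j => ∑ m ∈ Finset.Icc (-N : ℤ) N,
    t m * if ((k : ℕ) : ℤ) - ((j : ℕ) : ℤ) = m then 1 else 0

/-- The circulant matrix of the coefficients `t m` with `|m| ≤ N`. -/
noncomputable def bandCirculant (t : ℤ → ℝ) (N n : ℕ) : Matrix (Fin n) (Fin n) ℝ :=
  Matrix.of fun k j => ∑ m ∈ Finset.Icc (-N : ℤ) N,
    t m * if (n : ℤ) ∣ ((k : ℕ) : ℤ) - m - ((j : ℕ) : ℤ) then 1 else 0

/-- Exactly one of `0, …, n - 1` is congruent to `a` modulo `n`, and `g` sees only the residue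
class. -/
theorem sum_ite_dvd_mul_periodic {n : ℕ} (hn : 0 < n) {g : ℤ → ℝ} (hg : Function.Periodic g n)
    (a : ℤ) :
    ∑ j : Fin n, (if (n : ℤ) ∣ a - ((j : ℕ) : ℤ) then 1 else 0) * g (j : ℕ) = g a := by
  have hn' : (0 : ℤ) < n := by exact_mod_cast hn
  have h0 := Int.emod_nonneg a hn'.ne'
  have h1 := Int.emod_lt_of_pos a hn'
  have h2 := Int.mul_ediv_add_emod a n
  rw [Finset.sum_eq_single ⟨(a % n).toNat, by omega⟩]
  · have h3 : (((a % n).toNat : ℕ) : ℤ) = a % n := Int.toNat_of_nonneg h0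
    simp only [h3]
    rw [if_pos ⟨a / n, by linarith⟩, one_mul]
    have h4 := hg.int_mul (a / n) (a % n)
    rw [← h4]
    congr 1
    push_cast
    linarith
  · intro j _ hj
    rw [if_neg, zero_mul]
    intro hd
    apply hj
    have hjn := j.isLt
    have h5 : (n : ℤ) ∣ a % n - ((j : ℕ) : ℤ) := by
      have h6 : a % n - ((j : ℕ) : ℤ) = (a - ((j : ℕ) : ℤ)) - n * (a / n) := by linarith
      rw [h6]
      exact dvd_sub hd (dvd_mul_right _ _)
    have h7 := Int.eq_zero_of_abs_lt_dvd h5 (abs_lt.2 ⟨by omega, by omega⟩)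
    apply Fin.ext
    simp only
    omega
  · simp

/-- The eigenvalues of `bandCirculant t N n`. -/
noncomputable def bandEigenvalue (t : ℤ → ℝ) (N : ℕ) {n : ℕ} (l : Fin n) : ℝ :=
  ∑ m ∈ Finset.Icc (-N : ℤ) N,
    t m * Real.cos (2 * Real.pi * (m : ℝ) * (gammaFreq l : ℝ) / (n : ℝ))

theorem gammaWave_periodic {n : ℕ} (hn : 0 < n) (l : Fin n) :
    Function.Periodic (gammaWave l) n := by
  have hn' : (n : ℝ) ≠ 0 := Nat.cast_ne_zero.2 hn.ne'
  intro x
  have h : 2 * Real.pi * ((x + n : ℤ) : ℝ) * (gammaFreq l : ℝ) / (n : ℝ)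
      = 2 * Real.pi * (x : ℝ) * (gammaFreq l : ℝ) / (n : ℝ) + gammaFreq l * (2 * Real.pi) := by
    push_cast
    field_simp
  rw [gammaWave, gammaWave, h, Real.cos_add_int_mul_two_pi, Real.sin_add_int_mul_two_pi]

theorem sum_Icc_mul_sin_eq_zero {t : ℤ → ℝ} (ht : ∀ j, t (-j) = t j) (N : ℕ) (θ : ℤ → ℝ)
    (hθ : ∀ m, θ (-m) = -θ m) :
    ∑ m ∈ Finset.Icc (-N : ℤ) N, t m * Real.sin (θ m) = 0 := by
  have h : ∑ m ∈ Finset.Icc (-N : ℤ) N, t m * Real.sin (θ m)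
      = ∑ m ∈ Finset.Icc (-N : ℤ) N, -(t m * Real.sin (θ m)) :=
    Finset.sum_equiv (Equiv.neg ℤ)
      (fun m => by simp only [Finset.mem_Icc, Equiv.neg_apply]; omega)
      fun m _ => by simp [ht, hθ]
  rw [Finset.sum_neg_distrib] at h
  linarith

/-- By the addition formulas, convolution with even coefficients multiplies a wave by the cosine
sum; the cross term carries an odd sine sum, which vanishes. -/
theorem sum_Icc_mul_gammaWave_sub {t : ℤ → ℝ} (ht : ∀ j, t (-j) = t j) (N : ℕ) {n : ℕ} (l : Fin n)
    (x : ℤ) :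
    ∑ m ∈ Finset.Icc (-N : ℤ) N, t m * gammaWave l (x - m)
      = gammaWave l x * bandEigenvalue t N l := by
  have h0 := sum_Icc_mul_sin_eq_zero ht N
    (fun m => 2 * Real.pi * (m : ℝ) * (gammaFreq l : ℝ) / (n : ℝ)) fun m => by
      push_cast
      ring
  rw [bandEigenvalue, gammaWave]
  by_cases hl : (l : ℕ) ≤ n / 2
  · rw [if_pos hl, ← add_zero (_ * _), ← mul_zero (Real.sin
      (2 * Real.pi * (x : ℝ) * (gammaFreq l : ℝ) / (n : ℝ))), ← h0, Finset.mul_sum, Finset.mul_sum,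
      ← Finset.sum_add_distrib]
    refine Finset.sum_congr rfl fun m _ => ?_
    rw [gammaWave, if_pos hl]
    push_cast
    simp only [mul_sub, sub_mul, sub_div, Real.cos_sub]
    ring
  · rw [if_neg hl, ← sub_zero (_ * _), ← mul_zero (Real.cos
      (2 * Real.pi * (x : ℝ) * (gammaFreq l : ℝ) / (n : ℝ))), ← h0, Finset.mul_sum, Finset.mul_sum,
      ← Finset.sum_sub_distrib]
    refine Finset.sum_congr rfl fun m _ => ?_
    rw [gammaWave, if_neg hl]
    push_cast
    simp only [mul_sub, sub_mul, sub_div, Real.sin_sub]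
    ring

/-- Symmetric circulant matrices are `γ`-matrices. -/
theorem bandCirculant_eq {t : ℤ → ℝ} (ht : ∀ j, t (-j) = t j) (N n : ℕ) :
    bandCirculant t N n = gammaQ n * diagonal (bandEigenvalue t N) * (gammaQ n)ᵀ := by
  have h : bandCirculant t N n * gammaQ n = gammaQ n * diagonal (bandEigenvalue t N) := by
    ext k l
    have hn : 0 < n := k.pos
    rw [mul_diagonal, Matrix.mul_apply, gammaQ_apply, mul_assoc, ← sum_Icc_mul_gammaWave_sub ht,
      Finset.mul_sum]
    simp only [bandCirculant, Matrix.of_apply, Finset.sum_mul]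
    rw [Finset.sum_comm]
    refine Finset.sum_congr rfl fun m _ => ?_
    rw [← sum_ite_dvd_mul_periodic hn (gammaWave_periodic hn l), Finset.mul_sum, Finset.mul_sum]
    refine Finset.sum_congr rfl fun j _ => ?_
    rw [gammaQ_apply]
    ring
  rw [← h, Matrix.mul_assoc, gammaQ_mul_transpose, Matrix.mul_one]

/-- Only wrap-around survives: the `m` congruent to `k - j` modulo `n` but not equal to it. -/
theorem bandCirculant_sub_bandToeplitz_apply {t : ℤ → ℝ} {N n : ℕ} (k j : Fin n) :
    (bandCirculant t N n - bandToeplitz t N n) k j = ∑ m ∈ Finset.Icc (-N : ℤ) N,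
      t m * if (n : ℤ) ∣ ((k : ℕ) : ℤ) - m - ((j : ℕ) : ℤ) ∧
        ((k : ℕ) : ℤ) - ((j : ℕ) : ℤ) ≠ m then 1 else 0 := by
  rw [Matrix.sub_apply, bandCirculant, bandToeplitz, Matrix.of_apply, Matrix.of_apply,
    ← Finset.sum_sub_distrib]
  refine Finset.sum_congr rfl fun m _ => ?_
  rw [← mul_sub]
  congr 1
  by_cases h : ((k : ℕ) : ℤ) - ((j : ℕ) : ℤ) = m
  · rw [if_pos h, if_pos ⟨0, by omega⟩, if_neg (by tauto), sub_self]
  · simp [h]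

/-- A banded Toeplitz matrix and its circulant differ only in the first and last rows. -/
theorem bandCirculant_sub_bandToeplitz_eq_zero {t : ℤ → ℝ} {N n : ℕ} {k : Fin n}
    (hk : N ≤ (k : ℕ)) (hk' : (k : ℕ) + N < n) (j : Fin n) :
    (bandCirculant t N n - bandToeplitz t N n) k j = 0 := by
  rw [bandCirculant_sub_bandToeplitz_apply]
  refine Finset.sum_eq_zero fun m hm => ?_
  rw [if_neg, mul_zero]
  rintro ⟨hd, hne⟩
  have hj := j.isLt
  rw [Finset.mem_Icc] at hm
  -- In a middle row `k - m` stays in `[0, n)`, so there is no wrap-around.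
  have := Int.eq_zero_of_abs_lt_dvd hd (abs_lt.2 ⟨by omega, by omega⟩)
  omega

/-- Each `m` contributes to at most one column of a given row, so the bound is independent of `n`.
-/
theorem sum_abs_bandCirculant_sub_bandToeplitz_le {t : ℤ → ℝ} {N n : ℕ} (k : Fin n) :
    ∑ j, |(bandCirculant t N n - bandToeplitz t N n) k j| ≤ ∑ m ∈ Finset.Icc (-N : ℤ) N, |t m| := by
  have hn : 0 < n := k.pos
  calc ∑ j, |(bandCirculant t N n - bandToeplitz t N n) k j|
      ≤ ∑ j : Fin n, ∑ m ∈ Finset.Icc (-N : ℤ) N,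
          |t m| * ((if (n : ℤ) ∣ ((k : ℕ) : ℤ) - m - ((j : ℕ) : ℤ) then 1 else 0) * 1) := by
        refine Finset.sum_le_sum fun j _ => ?_
        rw [bandCirculant_sub_bandToeplitz_apply]
        refine (Finset.abs_sum_le_sum_abs _ _).trans (Finset.sum_le_sum fun m _ => ?_)
        rw [abs_mul]
        refine mul_le_mul_of_nonneg_left ?_ (abs_nonneg _)
        split_ifs <;> simp_all
    _ = ∑ m ∈ Finset.Icc (-N : ℤ) N, |t m| := by
        rw [Finset.sum_comm]
        refine Finset.sum_congr rfl fun m _ => ?_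
        rw [← Finset.mul_sum, sum_ite_dvd_mul_periodic (g := fun _ => 1) hn (fun _ => rfl), mul_one]

/-- The first `N` and the last `N` indices. -/
def cornerIndex {N n : ℕ} (h : N ≤ n) : Fin N ⊕ Fin N → Fin n :=
  Sum.elim (fun i => ⟨i, by omega⟩) fun i => ⟨n - 1 - i, by omega⟩

theorem exists_cornerIndex_eq {N n : ℕ} (h : N ≤ n) {k : Fin n}
    (hk : ¬(N ≤ (k : ℕ) ∧ (k : ℕ) + N < n)) : ∃ i, cornerIndex h i = k := by
  by_cases hkN : (k : ℕ) < N
  · exact ⟨Sum.inl ⟨k, hkN⟩, rfl⟩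
  · refine ⟨Sum.inr ⟨n - 1 - k, by omega⟩, Fin.ext ?_⟩
    simp only [cornerIndex, Sum.elim_inr]
    omega

theorem sum_sum_abs_bandCirculant_sub_bandToeplitz_le {t : ℤ → ℝ} {N n : ℕ} (h : N ≤ n) :
    ∑ k, ∑ j, |(bandCirculant t N n - bandToeplitz t N n) k j|
      ≤ 2 * N * ∑ m ∈ Finset.Icc (-N : ℤ) N, |t m| := by
  classical
  set K := bandCirculant t N n - bandToeplitz t N n with hK
  -- Summing over the image keeps the bound valid when the two groups of corner rows overlap.
  calc ∑ k, ∑ j, |K k j| = ∑ k ∈ Finset.univ.image (cornerIndex h), ∑ j, |K k j| := by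
        refine (Finset.sum_subset (Finset.subset_univ _) fun k _ hk => ?_).symm
        refine Finset.sum_eq_zero fun j _ => ?_
        by_cases hkc : N ≤ (k : ℕ) ∧ (k : ℕ) + N < n
        · rw [hK, bandCirculant_sub_bandToeplitz_eq_zero hkc.1 hkc.2, abs_zero]
        · obtain ⟨i, hi⟩ := exists_cornerIndex_eq h hkc
          exact absurd (Finset.mem_image.2 ⟨i, Finset.mem_univ _, hi⟩) hk
    _ ≤ ∑ k ∈ Finset.univ.image (cornerIndex h), ∑ m ∈ Finset.Icc (-N : ℤ) N, |t m| :=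
        Finset.sum_le_sum fun k _ => sum_abs_bandCirculant_sub_bandToeplitz_le k
    _ ≤ 2 * N * ∑ m ∈ Finset.Icc (-N : ℤ) N, |t m| := by
        rw [Finset.sum_const, nsmul_eq_mul]
        refine mul_le_mul_of_nonneg_right ?_ (by positivity)
        have := Finset.card_image_le (s := Finset.univ) (f := cornerIndex h)
        rw [Finset.card_univ, Fintype.card_sum, Fintype.card_fin] at this
        calc ((Finset.univ.image (cornerIndex h)).card : ℝ) ≤ ((N + N : ℕ) : ℝ) := by
              exact_mod_cast this
          _ = 2 * N := by
              push_cast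
              ring

/-- The Rayleigh quotients at the columns of `Q_n` are small for matrices with few entries. -/
theorem abs_gammaRayleigh_le {n : ℕ} (K : Matrix (Fin n) (Fin n) ℝ) (l : Fin n) :
    |gammaRayleigh K l| ≤ 2 / n * ∑ k, ∑ j, |K k j| := by
  rw [gammaRayleigh_eq_form]
  simp only [dotProduct, mulVec, Finset.mul_sum]
  refine (Finset.abs_sum_le_sum_abs _ _).trans (Finset.sum_le_sum fun k _ => ?_)
  refine (Finset.abs_sum_le_sum_abs _ _).trans (Finset.sum_le_sum fun j _ => ?_)
  rw [abs_mul, abs_mul, mul_left_comm, mul_comm]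
  refine mul_le_mul_of_nonneg_right ?_ (abs_nonneg _)
  calc |gammaQ n k l| * |gammaQ n j l| ≤ Real.sqrt (2 / n) * Real.sqrt (2 / n) :=
        mul_le_mul (abs_gammaQ_le _ _) (abs_gammaQ_le _ _) (abs_nonneg _) (Real.sqrt_nonneg _)
    _ = 2 / n := Real.mul_self_sqrt (by positivity)

end Band

/-! ### The tail of the coefficients -/

section Tail

/-- **Schur test** for symmetric matrices. -/
theorem abs_form_le_of_row_sums {n : ℕ} {R : Matrix (Fin n) (Fin n) ℝ} (hR : Rᵀ = R) {δ : ℝ}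
    (h : ∀ k, ∑ j, |R k j| ≤ δ) (x : Fin n → ℝ) : |x ⬝ᵥ (R *ᵥ x)| ≤ δ * (x ⬝ᵥ x) := by
  have h1 : |x ⬝ᵥ (R *ᵥ x)| ≤ ∑ k, ∑ j, (|R k j| * (x k ^ 2 / 2) + |R k j| * (x j ^ 2 / 2)) := by
    simp only [dotProduct, mulVec, Finset.mul_sum]
    refine (Finset.abs_sum_le_sum_abs _ _).trans (Finset.sum_le_sum fun k _ => ?_)
    refine (Finset.abs_sum_le_sum_abs _ _).trans (Finset.sum_le_sum fun j _ => ?_)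
    rw [abs_mul, abs_mul, mul_left_comm, ← mul_add]
    refine mul_le_mul_of_nonneg_left ?_ (abs_nonneg _)
    -- `|x_k x_j| ≤ (x_k² + x_j²) / 2`; by the symmetry of `R` both halves reduce to row sums.
    nlinarith [sq_nonneg (|x k| - |x j|), sq_abs (x k), sq_abs (x j)]
  have h2 : ∑ k, ∑ j, |R k j| * (x k ^ 2 / 2) ≤ ∑ k, δ * (x k ^ 2 / 2) := by
    refine Finset.sum_le_sum fun k _ => ?_
    rw [← Finset.sum_mul]
    exact mul_le_mul_of_nonneg_right (h k) (by positivity)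
  have h3 : ∑ k, ∑ j, |R k j| * (x j ^ 2 / 2) = ∑ k, ∑ j, |R k j| * (x k ^ 2 / 2) := by
    rw [Finset.sum_comm]
    refine Finset.sum_congr rfl fun k _ => Finset.sum_congr rfl fun j _ => ?_
    rw [← congrFun (congrFun hR k) j, transpose_apply]
  have h4 : ∑ k, δ * (x k ^ 2 / 2) = δ * (x ⬝ᵥ x) / 2 := by
    rw [dotProduct, Finset.mul_sum, Finset.sum_div]
    refine Finset.sum_congr rfl fun k _ => ?_
    ring
  simp only [Finset.sum_add_distrib] at h1
  linarith

theorem toeplitzMatrix_transpose (t : ℤ → ℝ) (n : ℕ) :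
    (toeplitzMatrix t n)ᵀ = toeplitzMatrix t n := by
  ext k j
  rw [transpose_apply, toeplitzMatrix, Matrix.of_apply, Matrix.of_apply, abs_sub_comm]

theorem toeplitzMatrix_sub_bandToeplitz_apply {t : ℤ → ℝ} (ht : ∀ j, t (-j) = t j) (N : ℕ) {n : ℕ}
    (k j : Fin n) :
    (toeplitzMatrix t n - bandToeplitz t N n) k j =
      if ((k : ℕ) : ℤ) - ((j : ℕ) : ℤ) ∈ Finset.Icc (-N : ℤ) N then 0
        else t (((k : ℕ) : ℤ) - ((j : ℕ) : ℤ)) := by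
  have habs : ∀ i, t |i| = t i := fun i => by
    rcases abs_choice i with h | h <;> rw [h]
    exact ht _
  rw [Matrix.sub_apply, toeplitzMatrix, bandToeplitz, Matrix.of_apply, Matrix.of_apply, habs]
  simp only [mul_ite, mul_one, mul_zero, Finset.sum_ite_eq]
  split_ifs <;> simp

/-- The offsets `k - j` along a row are distinct, so each row sum of the remainder is a sum of `|t
m|` over a finite set avoiding `[-N, N]`, and the Schur test applies. -/
theorem abs_form_toeplitz_sub_band_le {t : ℤ → ℝ} (ht : ∀ j, t (-j) = t j) {N n : ℕ} {δ : ℝ}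
    (hδ : ∀ s : Finset ℤ, Disjoint s (Finset.Icc (-N : ℤ) N) → ∑ m ∈ s, |t m| ≤ δ)
    (x : Fin n → ℝ) :
    |x ⬝ᵥ ((toeplitzMatrix t n - bandToeplitz t N n) *ᵥ x)| ≤ δ * (x ⬝ᵥ x) := by
  classical
  refine abs_form_le_of_row_sums ?_ (fun k => ?_) x
  · ext k j
    rw [transpose_apply, toeplitzMatrix_sub_bandToeplitz_apply ht,
      toeplitzMatrix_sub_bandToeplitz_apply ht, ← neg_sub, ht]
    congr 1
    simp only [Finset.mem_Icc, eq_iff_iff]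
    omega
  · let s : Finset ℤ := (Finset.univ.image fun j : Fin n => ((k : ℕ) : ℤ) - ((j : ℕ) : ℤ)) \
      Finset.Icc (-N : ℤ) N
    refine le_trans (le_of_eq ?_) (hδ s Finset.sdiff_disjoint)
    have hinj : Function.Injective fun j : Fin n => ((k : ℕ) : ℤ) - ((j : ℕ) : ℤ) := by
      intro i j hij
      apply Fin.ext
      simp only at hij
      omega
    have h1 : ∀ j : Fin n, |(toeplitzMatrix t n - bandToeplitz t N n) k j|
        = (fun m : ℤ => if m ∈ Finset.Icc (-N : ℤ) N then 0 else |t m|)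
          (((k : ℕ) : ℤ) - ((j : ℕ) : ℤ)) := by
      intro j
      rw [toeplitzMatrix_sub_bandToeplitz_apply ht]
      simp only
      split_ifs <;> simp
    simp only [h1]
    rw [← Finset.sum_image (f := fun m : ℤ => if m ∈ Finset.Icc (-N : ℤ) N then 0 else |t m|)
      hinj.injOn, Finset.sum_ite, Finset.sum_const_zero, zero_add, Finset.filter_notMem_eq_sdiff]

theorem exists_tail_le {t : ℤ → ℝ} (ht : Summable fun j => |t j|) {δ : ℝ} (hδ : 0 < δ) :
    ∃ N : ℕ, ∀ s : Finset ℤ, Disjoint s (Finset.Icc (-N : ℤ) N) → ∑ m ∈ s, |t m| ≤ δ := by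
  obtain ⟨s, hs⟩ := summable_iff_vanishing_norm.1 ht δ hδ
  refine ⟨s.sup Int.natAbs, fun u hu => ?_⟩
  have h := hs u (hu.mono_right fun m hm => ?_)
  · rw [Real.norm_of_nonneg (by positivity)] at h
    exact h.le
  · have := Finset.le_sup (f := Int.natAbs) hm
    rw [Finset.mem_Icc]
    omega

end Tail

/-! ### Clustering of the preconditioned spectrum -/

section Clustering

theorem form_gamma {n : ℕ} (w : Fin n → ℝ) (x : Fin n → ℝ) :
    x ⬝ᵥ ((gammaQ n * diagonal w * (gammaQ n)ᵀ) *ᵥ x)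
      = ∑ j, w j * ((gammaQ n)ᵀ *ᵥ x) j ^ 2 := by
  rw [← mulVec_mulVec, ← mulVec_mulVec, dotProduct_mulVec, ← mulVec_transpose, dotProduct]
  refine Finset.sum_congr rfl fun j _ => ?_
  rw [mulVec_diagonal]
  ring

theorem sum_sq_gammaQ_transpose_mulVec {n : ℕ} (x : Fin n → ℝ) :
    ∑ j, ((gammaQ n)ᵀ *ᵥ x) j ^ 2 = x ⬝ᵥ x := by
  have h := form_gamma (fun _ => 1) x
  rw [diagonal_one, Matrix.mul_one, gammaQ_mul_transpose, one_mulVec] at h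
  simpa using h.symm

theorem le_form_gamma {n : ℕ} {w : Fin n → ℝ} {a : ℝ} (hw : ∀ j, a ≤ w j) (x : Fin n → ℝ) :
    a * (x ⬝ᵥ x) ≤ x ⬝ᵥ ((gammaQ n * diagonal w * (gammaQ n)ᵀ) *ᵥ x) := by
  rw [form_gamma, ← sum_sq_gammaQ_transpose_mulVec, Finset.mul_sum]
  exact Finset.sum_le_sum fun j _ => mul_le_mul_of_nonneg_right (hw j) (sq_nonneg _)

theorem abs_form_gamma_le {n : ℕ} {w : Fin n → ℝ} {a : ℝ} (hw : ∀ j, |w j| ≤ a)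
    (x : Fin n → ℝ) :
    |x ⬝ᵥ ((gammaQ n * diagonal w * (gammaQ n)ᵀ) *ᵥ x)| ≤ a * (x ⬝ᵥ x) := by
  rw [form_gamma, ← sum_sq_gammaQ_transpose_mulVec, Finset.mul_sum]
  refine (Finset.abs_sum_le_sum_abs _ _).trans (Finset.sum_le_sum fun j _ => ?_)
  rw [abs_mul, abs_of_nonneg (sq_nonneg (((gammaQ n)ᵀ *ᵥ x) j))]
  exact mul_le_mul_of_nonneg_right (hw j) (sq_nonneg _)

/-- Off the first and last `N` coordinates, a Toeplitz matrix is close, as a form, to its optimal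
`γ`-approximation. -/
theorem abs_form_toeplitz_sub_optG_le {t : ℤ → ℝ} (ht : ∀ j, t (-j) = t j) {N n : ℕ} (hN : N ≤ n)
    {δ : ℝ} (hδ : ∀ s : Finset ℤ, Disjoint s (Finset.Icc (-N : ℤ) N) → ∑ m ∈ s, |t m| ≤ δ)
    {x : Fin n → ℝ} (hx : ∀ i, x (cornerIndex hN i) = 0) :
    |x ⬝ᵥ ((toeplitzMatrix t n - optG (toeplitzMatrix t n)) *ᵥ x)| ≤
      (2 * δ + 2 / n * (2 * N * ∑ m ∈ Finset.Icc (-N : ℤ) N, |t m|)) * (x ⬝ᵥ x) := by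
  set T := toeplitzMatrix t n with hT
  set P := bandToeplitz t N n with hP
  set C := bandCirculant t N n with hC
  -- In each row either `P - C` vanishes or the coordinate of `x` does.
  have hcorner : x ⬝ᵥ ((P - C) *ᵥ x) = 0 := by
    rw [← neg_sub, neg_mulVec, dotProduct_neg, neg_eq_zero]
    refine Finset.sum_eq_zero fun k _ => ?_
    by_cases hk : N ≤ (k : ℕ) ∧ (k : ℕ) + N < n
    · rw [mulVec, dotProduct, Finset.sum_eq_zero fun j _ => ?_, mul_zero]
      rw [hC, hP, bandCirculant_sub_bandToeplitz_eq_zero hk.1 hk.2, zero_mul]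
    · obtain ⟨i, rfl⟩ := exists_cornerIndex_eq hN hk
      rw [hx, zero_mul]
  have hdiff : C - optG T
      = gammaQ n * diagonal (fun j => bandEigenvalue t N j - gammaRayleigh T j) * (gammaQ n)ᵀ := by
    rw [optG_eq, hC, bandCirculant_eq ht, ← Matrix.sub_mul, ← Matrix.mul_sub, diagonal_sub]
  have hRC : ∀ j, gammaRayleigh C j = bandEigenvalue t N j := by
    intro j
    have h : (gammaQ n)ᵀ * C * gammaQ n = diagonal (bandEigenvalue t N) := by
      calc (gammaQ n)ᵀ * C * gammaQ n
          = ((gammaQ n)ᵀ * gammaQ n) * diagonal (bandEigenvalue t N) *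
              ((gammaQ n)ᵀ * gammaQ n) := by
            rw [hC, bandCirculant_eq ht]
            simp only [Matrix.mul_assoc]
        _ = _ := by rw [gammaQ_transpose_mul_self, Matrix.one_mul, Matrix.mul_one]
    rw [gammaRayleigh, h, diagonal_apply_eq]
  have hw : ∀ j, |bandEigenvalue t N j - gammaRayleigh T j|
      ≤ δ + 2 / n * (2 * N * ∑ m ∈ Finset.Icc (-N : ℤ) N, |t m|) := by
    intro j
    have h1 : |gammaRayleigh (C - P) j|
        ≤ 2 / n * (2 * N * ∑ m ∈ Finset.Icc (-N : ℤ) N, |t m|) :=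
      (abs_gammaRayleigh_le _ j).trans (mul_le_mul_of_nonneg_left
        (sum_sum_abs_bandCirculant_sub_bandToeplitz_le hN) (by positivity))
    have h2 : |gammaRayleigh (T - P) j| ≤ δ := by
      have := abs_form_toeplitz_sub_band_le ht hδ fun k => gammaQ n k j
      rwa [gammaQ_col_dotProduct_self, mul_one, ← gammaRayleigh_eq_form] at this
    -- `C` is a `γ`-matrix, so its eigenvalues are its own Rayleigh quotients; comparison with `T`
    -- goes through `P`.
    have h3 : bandEigenvalue t N j - gammaRayleigh T j
        = gammaRayleigh (C - P) j - gammaRayleigh (T - P) j := by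
      rw [gammaRayleigh_sub, gammaRayleigh_sub, hRC]
      ring
    rw [h3]
    exact (abs_sub _ _).trans (by linarith)
  have hsplit : x ⬝ᵥ ((T - optG T) *ᵥ x)
      = x ⬝ᵥ ((T - P) *ᵥ x) + x ⬝ᵥ ((P - C) *ᵥ x) + x ⬝ᵥ ((C - optG T) *ᵥ x) := by
    rw [← dotProduct_add, ← add_mulVec, ← dotProduct_add, ← add_mulVec, sub_add_sub_cancel,
      sub_add_sub_cancel]
  have h4 := abs_form_toeplitz_sub_band_le ht hδ x
  have h5 := abs_form_gamma_le hw x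
  rw [← hdiff] at h5
  rw [hsplit, hcorner, add_zero]
  refine (abs_add_le _ _).trans ((add_le_add h4 h5).trans (le_of_eq ?_))
  ring

theorem isUnit_gamma {n : ℕ} {v : Fin n → ℝ} (hv : ∀ j, v j ≠ 0) :
    IsUnit (gammaQ n * diagonal v * (gammaQ n)ᵀ) := by
  have hQ : IsUnit (gammaQ n) := IsUnit.of_mul_eq_one _ (gammaQ_mul_transpose n)
  have hQt : IsUnit (gammaQ n)ᵀ := IsUnit.of_mul_eq_one _ (gammaQ_transpose_mul_self n)
  refine (hQ.mul ?_).mul hQt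
  rw [isUnit_diagonal, Pi.isUnit_iff]
  exact fun j => (hv j).isUnit

/-- The spectrum of the preconditioned matrix is clustered around `1`, for positive symbols. -/
theorem IsWienerSymbol.clustering_of_pos {f : Circle → ℝ} {t : ℤ → ℝ} (hf : IsWienerSymbol f t)
    {m : ℝ} (hm : 0 < m) (hmf : ∀ z, m ≤ f z) {ε : ℝ} (hε : 0 < ε) :
    ∃ k n₁ : ℕ, ∀ n : ℕ, n₁ ≤ n → IsUnit (optG (toeplitzMatrix t n)) ∧
      numEigenvaluesFarFromOne ((optG (toeplitzMatrix t n))⁻¹ * toeplitzMatrix t n) ε < k := by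
  -- The tail enters twice, costing `ε * m / 2`; `n ≥ 8 N S / (ε m)` makes the corner term `4 N S /
  -- n` at most the other half.
  obtain ⟨N, hN⟩ := exists_tail_le hf.summable (δ := ε * m / 4) (by positivity)
  set S := ∑ m ∈ Finset.Icc (-N : ℤ) N, |t m| with hS
  have hS0 : 0 ≤ S := by positivity
  obtain ⟨n₀, hn₀⟩ := exists_nat_ge (8 * N * S / (ε * m))
  -- There are `2 N` corner constraints, so at most `4 N` outliers; `n₀ + 1` keeps `n` positive.
  refine ⟨4 * N + 1, max N (n₀ + 1), fun n hn => ?_⟩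
  have hNn : N ≤ n := (le_max_left _ _).trans hn
  have hn₀n : n₀ + 1 ≤ n := (le_max_right _ _).trans hn
  have hn0 : (0 : ℝ) < n := Nat.cast_pos.2 (by omega)
  have hv : ∀ j, m ≤ gammaRayleigh (toeplitzMatrix t n) j := by
    intro j
    have := hf.le_form hmf fun k => gammaQ n k j
    rwa [gammaQ_col_dotProduct_self, mul_one, ← gammaRayleigh_eq_form] at this
  have hv0 : ∀ j, 0 < gammaRayleigh (toeplitzMatrix t n) j := fun j => hm.trans_le (hv j)
  have hsmall : 2 * (ε * m / 4) + 2 / n * (2 * N * S) ≤ ε * m := by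
    have h1 : 8 * N * S / (ε * m) ≤ n := hn₀.trans (by exact_mod_cast (by omega : n₀ ≤ n))
    rw [div_le_iff₀ (by positivity)] at h1
    have h2 : 2 / n * (2 * N * S) ≤ ε * m / 2 := by
      rw [div_mul_eq_mul_div, div_le_iff₀ hn0]
      linarith
    linarith
  refine ⟨?_, ?_⟩
  · rw [optG_eq]
    exact isUnit_gamma fun j => (hv0 j).ne'
  · have h := numEigenvaluesFarFromOne_le (ε := ε) (gammaQ_transpose_mul_self n) hv0
      (toeplitzMatrix_transpose t n) (LinearMap.funLeft ℝ ℝ (cornerIndex hNn)) fun x hx => by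
        have h1 := abs_form_toeplitz_sub_optG_le hf.symm hNn hN (x := x) fun i => congrFun hx i
        have h2 := le_form_gamma hv x
        have h3 : 0 ≤ x ⬝ᵥ x := by
          rw [← sum_sq_gammaQ_transpose_mulVec]
          positivity
        rw [optG_eq] at h1
        calc _ ≤ _ := h1
          _ ≤ ε * m * (x ⬝ᵥ x) := mul_le_mul_of_nonneg_right hsmall h3
          _ = ε * (m * (x ⬝ᵥ x)) := mul_assoc _ _ _
          _ ≤ _ := mul_le_mul_of_nonneg_left h2 hε.le
    rw [Fintype.card_sum, Fintype.card_fin, ← optG_eq] at h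
    omega

theorem optG_neg {n : ℕ} (T : Matrix (Fin n) (Fin n) ℝ) : optG (-T) = -optG T := by
  have h : gammaRayleigh (-T) = fun j => -gammaRayleigh T j := by
    funext j
    rw [gammaRayleigh, Matrix.mul_neg, Matrix.neg_mul]
    rfl
  rw [optG_eq, optG_eq, h, ← diagonal_neg, Matrix.mul_neg, Matrix.neg_mul]

theorem neg_inv_mul_neg {n : ℕ} {G : Matrix (Fin n) (Fin n) ℝ} (hG : IsUnit G)
    (T : Matrix (Fin n) (Fin n) ℝ) : (-G)⁻¹ * (-T) = G⁻¹ * T := by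
  have h : (-G)⁻¹ = -G⁻¹ := inv_eq_left_inv (by
    rw [neg_mul_neg, nonsing_inv_mul _ ((isUnit_iff_isUnit_det _).1 hG)])
  rw [h, neg_mul_neg]

/-- A continuous nonvanishing function on the circle has constant sign. -/
theorem Circle.forall_pos_or_forall_neg {f : Circle → ℝ} (hf : Continuous f) (h : ∀ z, f z ≠ 0) :
    (∀ z, 0 < f z) ∨ ∀ z, f z < 0 := by
  by_contra! hc
  obtain ⟨⟨z, hz⟩, w, hw⟩ := hc
  -- Lifting to the angle allows the intermediate value theorem on `ℝ`.
  have hg : Continuous fun θ : ℝ => f (Circle.exp θ) := hf.comp Circle.exp.continuous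
  rw [← Circle.exp_arg z] at hz
  rw [← Circle.exp_arg w] at hw
  obtain ⟨θ, hθ⟩ := mem_range_of_exists_le_of_exists_ge hg ⟨_, hz⟩ ⟨_, hw⟩
  exact h _ hθ

end Clustering

end

/-! ### The theorem -/

theorem mainTheorem1 (f : Circle → ℝ) (t : ℤ → ℝ) (hf : IsWienerSymbol f t) :
    (∃ fmin fmax : ℝ, IsLeast (Set.range f) fmin ∧ IsGreatest (Set.range f) fmax ∧
      ∀ ε : ℝ, 0 < ε → ∃ n₀ : ℕ, 0 < n₀ ∧ ∀ n : ℕ, n₀ ≤ n → ∀ μ : ℝ,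
        Module.End.HasEigenvalue (Matrix.toLin' (optG (toeplitzMatrix t n))) μ →
          μ ∈ Set.Icc (fmin - ε) (fmax + ε)) ∧
    ((∀ z : Circle, f z ≠ 0) →
      ∀ ε : ℝ, 0 < ε → ∃ k n₁ : ℕ, ∀ n : ℕ, n₁ ≤ n →
        IsUnit (optG (toeplitzMatrix t n)) ∧
        numEigenvaluesFarFromOne
          ((optG (toeplitzMatrix t n))⁻¹ * toeplitzMatrix t n) ε < k) := by
  have hcomp : IsCompact (Set.range f) := isCompact_range hf.continuous
  obtain ⟨a, ha⟩ := hcomp.exists_isLeast (Set.range_nonempty f)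
  obtain ⟨b, hb⟩ := hcomp.exists_isGreatest (Set.range_nonempty f)
  have haf : ∀ z, a ≤ f z := fun z => ha.2 ⟨z, rfl⟩
  have hbf : ∀ z, f z ≤ b := fun z => hb.2 ⟨z, rfl⟩
  refine ⟨⟨a, b, ha, hb, fun ε hε => ⟨1, one_pos, fun n _ μ hμ => ?_⟩⟩, fun h0 ε hε => ?_⟩
  · rw [optG_eq] at hμ
    obtain ⟨j, rfl⟩ := exists_eq_of_hasEigenvalue_gamma hμ
    have h1 := hf.le_form haf fun k => gammaQ n k j
    have h2 := hf.form_le hbf fun k => gammaQ n k j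
    rw [gammaQ_col_dotProduct_self, mul_one, ← gammaRayleigh_eq_form] at h1 h2
    exact ⟨by linarith, by linarith⟩
  -- For negative `f`, both `T` and its optimal approximation change sign with `f`, so `G⁻¹ T` is
  -- the same for `-f`.
  · rcases Circle.forall_pos_or_forall_neg hf.continuous h0 with hpos | hneg
    · obtain ⟨z, hz⟩ := ha.1
      exact hf.clustering_of_pos (hz ▸ hpos z) haf hε
    · obtain ⟨z, hz⟩ := hb.1
      obtain ⟨k, n₁, h⟩ := hf.neg.clustering_of_pos (m := -b) (neg_pos.2 (hz ▸ hneg z))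
        (fun w => neg_le_neg (hbf w)) hε
      refine ⟨k, n₁, fun n hn => ?_⟩
      obtain ⟨h1, h2⟩ := h n hn
      rw [toeplitzMatrix_neg, optG_neg] at h1 h2
      rw [IsUnit.neg_iff] at h1
      exact ⟨h1, by rwa [neg_inv_mul_neg h1] at h2⟩
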